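/- For polynomials $P,Q\in\mathbb{C}[x]$ with zeros $x_1,\dots,x_N$ and $y_1,\dots,y_M$ respectively (listed with multiplicity), let $\mathrm{PER}(P(x),Q(y))$ denote the permanent of the $N\times M$ matrix $\bigl(1/(x_i-y_j)\bigr)_{1\le i\le N,\,1\le j\le M}$, where the permanent of an $N\times M$ matrix $A=(a_{ij})$ is $\sum_\sigma\prod_{i=1}^N a_{i,\sigma(i)}$, the sum being over all injections $\sigma:\{1,\dots,N\}\to\{1,\dots,M\}$. Let $(\alpha)_k:=\alpha(\alpha+1)\cdots(\alpha+k-1)$ for $k\ge 1$ and $(\alpha)_0:=1$. Then for all positive integers $m$ and $n$, $$\mathrm{PER}(x^n-1,\;y^{mn}+1)=-\left(-\frac{mn}{2}\right)_n .$$ In particular (the case $m=1$, Scott's identity), for every positive integer $n$, $$\mathrm{PER}(x^n-1,\;y^{n}+1)=\begin{cases}(-1)^{\frac{n-1}{2}}\,\dfrac{n\,\bigl(1\cdot 3\cdot 5\cdots (n-2)\bigr)^2}{2^n}, & n \text{ odd},\\[2mm] 0, & n\text{ even},\end{cases}$$ where the product $1\cdot3\cdot5\cdots(n-2)$ is empty,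 hence equal to $1$, for $n=1$. -/

import Mathlib

open Polynomial

/-- The permanent of a rectangular matrix: the sum of all products of entries, one from every row,
no two of them from the same column (it is `0` if there are more rows than columns). -/
noncomputable def rectPermanent {ι κ R : Type*} [Fintype ι] [Fintype κ] [DecidableEq ι]
    [DecidableEq κ] [CommSemiring R] (A : Matrix ι κ R) : R :=
  ∑ σ : ι ↪ κ, ∏ i, A i (σ i)

open Classical in
/-- The Scott-type permanent `PER(P(x), Q(y))`: the permanent of the matrix
`(1 / (x_i - y_j))`, where the `x_i` are the complex zeros of `P` and the `y_j` those of `Q`,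
listed with multiplicity. Rows and columns are indexed by the multisets of zeros themselves (an
index is a zero together with a copy number below its multiplicity), so no ordering is chosen. -/
noncomputable def scottPER (P Q : ℂ[X]) : ℂ :=
  rectPermanent (Matrix.of fun (i : P.roots) (j : Q.roots) => 1 / (i.1 - j.1))

/-! Inclusion–exclusion writes a permanent as a polynomial in the column sums of products of rows.
If these sums are those of `α` equal columns `c`, the value is `α(α-1)⋯(α-n+1) ∏ c i`. Here `∑ j,
1/(x i - y j) = Q'(x i)/Q(x i) = (mn/2)/x i` because `x i ^ (mn) = 1`, and partial fractions extend
this to all products of distinct rows, so `α = mn/2` and `c i = 1/x i`. -/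

/-- The sum over injections factors as if all columns were `α` copies of the single column `c`,
as soon as the power sums of the columns do. -/
theorem sum_embedding_fin_eq_of_sum_prod {κ R : Type*} [Fintype κ] [DecidableEq κ] [CommRing R]
    (α : R) (n : ℕ) (f : Fin n → κ → R) (c : Fin n → R)
    (h : ∀ B : Finset (Fin n), B.Nonempty → ∑ j, ∏ i ∈ B, f i j = α * ∏ i ∈ B, c i) :
    ∑ σ : Fin n ↪ κ, ∏ i, f i (σ i) = (descPochhammer R n).eval α * ∏ i, c i := by
  induction n with
  | zero => simp
  | succ n ih =>
    have hcompl (e : Fin n ↪ κ) : ∑ j : {j // j ∉ Set.range e}, f 0 j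
        = α * c 0 - ∑ k, f 0 (e k) := by
      have h0 : ∑ j, f 0 j = α * c 0 := by simpa using h {0} (by simp)
      have hrange : ∑ k, f 0 (e k) = ∑ j : {j // j ∈ Set.range e}, f 0 j :=
        Fintype.sum_equiv (Equiv.ofInjective e e.injective) _ _ fun _ => by
          simp only [Equiv.ofInjective_apply]
      rw [← h0, eq_sub_iff_add_eq,
        ← Fintype.sum_subtype_add_sum_subtype (fun j => j ∈ Set.range e) (f 0), add_comm, hrange]
      congr!
    have hrest : ∑ σ : Fin n ↪ κ, ∏ i, f i.succ (σ i)
        = (descPochhammer R n).eval α * ∏ i : Fin n, c i.succ :=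
      ih _ _ fun B hB => by simpa using h (B.map (Fin.succEmb n)) (by simpa using hB)
    -- A collision of row `0` with row `k` multiplies the two rows; the merged family again
    -- satisfies the hypothesis, with `c 0 * c k` in place `k`.
    have habsorb (k : Fin n) : ∑ σ : Fin n ↪ κ, f 0 (σ k) * ∏ i, f i.succ (σ i)
        = (descPochhammer R n).eval α * (c 0 * ∏ i : Fin n, c i.succ) := by
      have := ih (fun i j => (if i = k then f 0 j else 1) * f i.succ j)
        (fun i => (if i = k then c 0 else 1) * c i.succ) fun B hB => by
          simp only [Finset.prod_mul_distrib, Finset.prod_ite_eq']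
          by_cases hk : k ∈ B
          · simpa [hk, Finset.prod_cons] using
              h (Finset.cons 0 (B.map (Fin.succEmb n)) (by simp [Fin.succ_ne_zero])) (by simp)
          · simpa [hk] using h (B.map (Fin.succEmb n)) (by simpa using hB)
      simpa only [Finset.prod_mul_distrib, Finset.prod_ite_eq', Finset.mem_univ, if_true] using this
    rw [← (Equiv.embeddingFinSucc n κ).symm.sum_comp, Fintype.sum_sigma]
    simp only [Equiv.coe_embeddingFinSucc_symm, Fin.prod_univ_succ, Fin.cons_zero, Fin.cons_succ,
      ← Finset.sum_mul, hcompl, sub_mul, Finset.sum_sub_distrib, ← Finset.mul_sum, hrest]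
    simp only [Finset.sum_mul]
    rw [Finset.sum_comm]
    simp only [habsorb, Finset.sum_const, Finset.card_univ, Fintype.card_fin, nsmul_eq_mul,
      descPochhammer_succ_eval]
    ring

theorem rectPermanent_eq_of_sum_prod {ι κ R : Type*} [Fintype ι] [Fintype κ] [DecidableEq ι]
    [DecidableEq κ] [CommRing R] (A : Matrix ι κ R) (α : R) (c : ι → R)
    (h : ∀ B : Finset ι, B.Nonempty → ∑ j, ∏ i ∈ B, A i j = α * ∏ i ∈ B, c i) :
    rectPermanent A = (descPochhammer R (Fintype.card ι)).eval α * ∏ i, c i := by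
  let e := Fintype.equivFin ι
  have key := sum_embedding_fin_eq_of_sum_prod α (Fintype.card ι) (fun i => A (e.symm i))
    (fun i => c (e.symm i)) fun B hB => by
      simpa using h (B.map e.symm.toEmbedding) (by simpa using hB)
  rw [← e.symm.prod_comp c, ← key, rectPermanent,
    ← (e.symm.embeddingCongr (Equiv.refl κ)).sum_comp]
  refine Finset.sum_congr rfl fun σ _ => ?_
  rw [← e.symm.prod_comp]
  simp [Equiv.embeddingCongr]

/-- Partial fractions: the power sums of the columns `1 / (x i - y j)` are determined by the
row sums. -/
theorem sum_prod_one_div_sub {ι κ K : Type*} [Fintype κ] [DecidableEq ι] [Field K]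
    (x : ι → K) (y : κ → K) (α : K) (hx : Function.Injective x) (hx0 : ∀ i, x i ≠ 0)
    (hxy : ∀ i j, x i ≠ y j) (h : ∀ i, ∑ j, 1 / (x i - y j) = α * (1 / x i))
    (B : Finset ι) (hB : B.Nonempty) :
    ∑ j, ∏ i ∈ B, 1 / (x i - y j) = α * ∏ i ∈ B, 1 / x i := by
  obtain ⟨a, C, ha, rfl⟩ : ∃ a C, a ∉ C ∧ insert a C = B :=
    ⟨hB.choose, B.erase hB.choose, by simp, Finset.insert_erase hB.choose_spec⟩
  clear hB
  induction C using Finset.induction_on generalizing a with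
  | empty => simpa using h a
  -- Since `a` is generalized, `ih` covers both `insert a C` and `insert b C`. The same partial
  -- fraction with `y = 0` recombines the right-hand sides.
  | insert b C hb ih =>
    have hab : a ≠ b := fun hab => ha (by simp [hab])
    have haC : a ∉ C := fun haC => ha (by simp [haC])
    have hba : x b - x a ≠ 0 := sub_ne_zero.2 (hx.ne hab.symm)
    have e1 := ih a haC
    have e2 := ih b hb
    rw [Finset.prod_insert haC] at e1
    rw [Finset.prod_insert hb] at e2
    simp only [Finset.prod_insert haC, Finset.prod_insert hb] at e1 e2
    rw [Finset.prod_insert ha, Finset.prod_insert hb]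
    simp only [Finset.prod_insert ha, Finset.prod_insert hb]
    have split (j : κ) : 1 / (x a - y j) * (1 / (x b - y j) * ∏ i ∈ C, 1 / (x i - y j))
        = (1 / (x a - y j) * (∏ i ∈ C, 1 / (x i - y j))
          - 1 / (x b - y j) * (∏ i ∈ C, 1 / (x i - y j))) / (x b - x a) := by
      have := sub_ne_zero.2 (hxy a j)
      have := sub_ne_zero.2 (hxy b j)
      rw [eq_div_iff hba, ← sub_mul, ← mul_assoc, mul_right_comm]
      congr 1
      field_simp
      ring
    rw [Finset.sum_congr rfl fun j _ => split j, ← Finset.sum_div, Finset.sum_sub_distrib, e1, e2,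
      div_eq_iff hba]
    have := hx0 a
    have := hx0 b
    field_simp

theorem prod_roots_X_pow_sub_one {n : ℕ} (hn : 1 ≤ n) :
    (X ^ n - 1 : ℂ[X]).roots.prod = (-1) ^ (n + 1) := by
  have hm : (X ^ n - 1 : ℂ[X]).Monic := monic_X_pow_sub_C 1 (by omega)
  have hd : (X ^ n - 1 : ℂ[X]).natDegree = n := natDegree_X_pow_sub_C
  have := (IsAlgClosed.splits (X ^ n - 1 : ℂ[X])).coeff_zero_eq_prod_roots_of_monic hm
  rw [hd] at this
  have h0 : (X ^ n - 1 : ℂ[X]).coeff 0 = -1 := by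
    rw [coeff_zero_eq_eval_zero]
    simp [show n ≠ 0 by omega]
  rw [h0] at this
  have h1 : ((-1 : ℂ) ^ n) * (-1) ^ n = 1 := by rw [← mul_pow]; simp
  calc _ = ((-1 : ℂ) ^ n) * (-1) ^ n * (X ^ n - 1 : ℂ[X]).roots.prod := by rw [h1, one_mul]
    _ = _ := by rw [mul_assoc, ← this, pow_succ]

theorem scottPER_X_pow_sub_one (m n : ℕ) (hm : 1 ≤ m) (hn : 1 ≤ n) :
    scottPER (X ^ n - 1) (X ^ (m * n) + 1) =
      -(ascPochhammer ℂ n).eval (-((m : ℂ) * (n : ℂ)) / 2) := by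
  classical
  have hd : (X ^ n - 1 : ℂ[X]).natDegree = n := natDegree_X_pow_sub_C
  have hP : (X ^ n - 1 : ℂ[X]) ≠ 0 := X_pow_sub_C_ne_zero (by omega) 1
  have hmn : m * n ≠ 0 := by positivity
  have hsplit := IsAlgClosed.splits (X ^ (m * n) + 1 : ℂ[X])
  have hQ0 : (X ^ (m * n) + 1 : ℂ[X]) ≠ 0 := (monic_X_pow_add_C 1 hmn).ne_zero
  have hnodup : (X ^ n - 1 : ℂ[X]).roots.Nodup :=
    nodup_roots (X_pow_sub_one_separable_iff.2 (by exact_mod_cast (by omega : n ≠ 0)))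
  have hroot (i : (X ^ n - 1 : ℂ[X]).roots) : i.1 ^ n = 1 := by
    have := (mem_roots hP).1 (Multiset.coe_mem (x := i))
    simpa [sub_eq_zero] using this
  have hx0 (i : (X ^ n - 1 : ℂ[X]).roots) : i.1 ≠ 0 := fun h0 => by
    simpa [h0, show n ≠ 0 by omega] using hroot i
  have hpow (i : (X ^ n - 1 : ℂ[X]).roots) : i.1 ^ (m * n) = 1 := by
    rw [mul_comm, pow_mul, hroot, one_pow]
  have heval (i : (X ^ n - 1 : ℂ[X]).roots) : (X ^ (m * n) + 1 : ℂ[X]).eval i.1 = 2 := by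
    simp [hpow i]; norm_num
  have hinj : Function.Injective (fun i : (X ^ n - 1 : ℂ[X]).roots => i.1) := by
    rintro ⟨a, i⟩ ⟨b, j⟩ (rfl : a = b)
    have := Multiset.nodup_iff_count_le_one.1 hnodup a
    exact congrArg _ (Fin.ext (by omega))
  have key := rectPermanent_eq_of_sum_prod
    (Matrix.of fun (i : (X ^ n - 1 : ℂ[X]).roots) (j : (X ^ (m * n) + 1 : ℂ[X]).roots) =>
      1 / (i.1 - j.1)) ((m * n : ℂ) / 2) (fun i => 1 / i.1)
    (sum_prod_one_div_sub (fun i : (X ^ n - 1 : ℂ[X]).roots => i.1)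
      (fun j : (X ^ (m * n) + 1 : ℂ[X]).roots => j.1) _ hinj hx0
      (fun i j hij => by
        have := (mem_roots hQ0).1 (Multiset.coe_mem (x := j))
        rw [IsRoot.def, ← hij, heval] at this
        norm_num at this)
      (fun i => by
        -- The row sum is the logarithmic derivative of `X ^ (m * n) + 1`.
        have h1 := hsplit.eval_derivative_div_eval_of_ne_zero (x := i.1) (by simp [heval])
        rw [heval, ← Multiset.map_univ] at h1
        refine h1.symm.trans ?_
        have h2 : i.1 ^ (m * n - 1) * i.1 = 1 := by rw [← pow_succ, Nat.sub_add_cancel, hpow]; omega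
        simp only [derivative_add, derivative_X_pow, derivative_one, add_zero, eval_mul, eval_pow,
          eval_X, eval_C]
        rw [eq_inv_of_mul_eq_one_left h2]
        push_cast
        ring))
  rw [Multiset.card_coe, (splits_iff_card_roots.1 (IsAlgClosed.splits _)), hd] at key
  have hprod : ∏ i : (X ^ n - 1 : ℂ[X]).roots, 1 / i.1 = (-1) ^ (n + 1) := by
    simp only [one_div]
    rw [Finset.prod_inv_distrib, ← Multiset.prod_eq_prod_coe, prod_roots_X_pow_sub_one hn,
      ← inv_pow]
    norm_num
  rw [hprod] at key
  -- Reflection contributes `(-1)^n`, against `(-1)^(n+1)` from the roots: hence the minus sign.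
  rw [neg_div, ascPochhammer_eval_neg_eq_descPochhammer]
  unfold scottPER
  convert key using 1
  ring

theorem ascPochhammer_eval_neg_odd_half (k : ℕ) :
    -(ascPochhammer ℂ (2 * k + 1)).eval (-(2 * (k : ℂ) + 1) / 2) =
      (-1) ^ k * ((2 * (k : ℂ) + 1) * (∏ i ∈ Finset.range k, (2 * (i : ℂ) + 1)) ^ 2
        / 2 ^ (2 * k + 1)) := by
  induction k with
  | zero => simp; norm_num
  | succ k ih =>
    -- Two new factors appear, one at each end: `-(2k+3)/2` and `(2k+1)/2`.
    have hstep : (ascPochhammer ℂ (2 * (k + 1) + 1)).eval (-(2 * ((k + 1 : ℕ) : ℂ) + 1) / 2)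
        = (ascPochhammer ℂ (2 * k + 1)).eval (-(2 * (k : ℂ) + 1) / 2) *
          (-((2 * (k : ℂ) + 3) * (2 * k + 1)) / 4) := by
      rw [show 2 * (k + 1) + 1 = (2 * k + 1 + 1) + 1 by ring, ascPochhammer_succ_left, eval_mul,
        eval_comp, ascPochhammer_succ_eval]
      simp only [eval_X, eval_add, eval_one]
      rw [show -(2 * ((k + 1 : ℕ) : ℂ) + 1) / 2 + 1 = -(2 * (k : ℂ) + 1) / 2 by push_cast; ring]
      push_cast
      ring
    rw [hstep, ← neg_mul, ih, Finset.prod_range_succ]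
    push_cast
    ring

/-- The rising product starts at the integer `-n/2` and passes through `0`. -/
theorem ascPochhammer_eval_neg_half_of_even {n : ℕ} (hn : 1 ≤ n) (he : Even n) :
    (ascPochhammer ℂ n).eval (-(n : ℂ) / 2) = 0 := by
  obtain ⟨k, rfl⟩ := he
  rw [show -((k + k : ℕ) : ℂ) / 2 = -(k : ℂ) by push_cast; ring]
  exact ascPochhammer_eval_neg_coe_nat_of_lt (by omega)

theorem corollary17 :
    (∀ m n : ℕ, 1 ≤ m → 1 ≤ n →
      scottPER (X ^ n - 1) (X ^ (m * n) + 1) =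
        -(ascPochhammer ℂ n).eval (-((m : ℂ) * (n : ℂ)) / 2)) ∧
    (∀ n : ℕ, 1 ≤ n →
      scottPER (X ^ n - 1) (X ^ n + 1) =
        if Odd n then
          (-1 : ℂ) ^ ((n - 1) / 2) *
            ((n : ℂ) * (∏ k ∈ Finset.range ((n - 1) / 2), (2 * (k : ℂ) + 1)) ^ 2 / 2 ^ n)
        else 0) := by
  refine ⟨scottPER_X_pow_sub_one, fun n hn => ?_⟩
  have h := scottPER_X_pow_sub_one 1 n le_rfl hn
  rw [one_mul, Nat.cast_one, one_mul] at h
  rw [h]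
  split_ifs with hodd
  · obtain ⟨k, rfl⟩ := hodd
    have := ascPochhammer_eval_neg_odd_half k
    rw [show (2 * k + 1 - 1) / 2 = k by omega]
    push_cast
    exact this
  · rw [ascPochhammer_eval_neg_half_of_even hn (Nat.not_odd_iff_even.1 hodd), neg_zero]
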